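/- Let $X$ be a compact metric space with metric $\rho$ and $T:X\to X$ continuous; we call $(X,T)$ a topological dynamical system. For $A\subseteq\mathbb N_0$ write $d(A)=1$ if $|A\cap[0,n)|/n\to1$. Let $X^\infty=X^{\mathbb N_0}$ carry the product topology. A sequence $(x_n)_{n\ge0}\in X^\infty$ is a *vague pseudo-orbit* of $(X,T)$ if for every open $\mathcal U\subseteq X^\infty$ that contains all orbits $(z,Tz,T^2z,\dots)$, $z\in X$, one has $d(\{n:(x_{n+i})_{i\ge0}\in\mathcal U\})=1$. $(X,T)$ has the *vague specification property* if for every vague pseudo-orbit $(x_n)$ there is $z\in X$ such that $d(\{n:\rho(T^nz,x_n)<\varepsilon\})=1$ for every $\varepsilon>0$. $(X,T)$ has the *weak specification property* if for every $\varepsilon>0$ there is a nondecreasing $M:\mathbb N_0\to\mathbb N_0$ with $M(n)/n\to0$ such that for all integers $0\le a_1\le b_1<a_2\le b_2<\dots<a_m\le b_m$ with $a_i-b_{i-1}\ge M(b_i-a_i+1)$ for $2\le i\le m$ and all $x_1,\dots,x_m\in X$ there is $y\in X$ with $\rho(T^ky,T^kx_i)\le\varepsilon$ whenever $1\le i\le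 m$ and $a_i\le k\le b_i$. $(X,T)$ has the *almost specification property* if there are $g:\mathbb N_0\times(0,\infty)\to\mathbb N_0$, with $g(\cdot,\varepsilon)$ nondecreasing and $g(n,\varepsilon)/n\to0$ as $n\to\infty$ for every $\varepsilon>0$, and $k:(0,\infty)\to\mathbb N_0$ such that for all $m\ge1$, $\varepsilon_1,\dots,\varepsilon_m>0$, $x_1,\dots,x_m\in X$ and $n_j\ge k(\varepsilon_j)$ there is $y\in X$ such that for each $j\le m$ the inequality $\rho(T^{i}x_j,T^{n_1+\dots+n_{j-1}+i}y)<\varepsilon_j$ holds for all but at most $g(n_j,\varepsilon_j)$ of the indices $0\le i<n_j$. **Corollary.** The vague specification property is strictly weaker than the weak specification property: every topological dynamical system with the weak specification property has the vague specification property, and there is a topological dynamical system, on a nonempty compact metric space, that has the almost specification property and the vague specification property but does not have the weak specification property. -/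

import Mathlib

open Filter Topology

/-- The set `A` of nonnegative integers has asymptotic density `d`, i.e. its upper and lower
asymptotic densities both equal `d`: `|A ∩ [0, n)| / n → d`. -/
def HasAsymptoticDensity (A : Set ℕ) (d : ℝ) : Prop :=
  Tendsto (fun n : ℕ => ((A ∩ Set.Iio n).ncard : ℝ) / (n : ℝ)) atTop (𝓝 d)

section Vague

variable {X : Type*} [MetricSpace X]

/-- The space `Γ_T` of all orbits `(x, T x, T² x, …)` inside the space `X^∞ = (ℕ → X)` of
sequences. -/
def orbitSpace (T : X → X) : Set (ℕ → X) :=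
  Set.range fun (x : X) (n : ℕ) => T^[n] x

/-- `x` is a vague pseudo-orbit of `T`: for every open neighbourhood `U` of `Γ_T` in `X^∞`
(product topology), the set of `n` such that the shifted sequence `(x_n, x_{n+1}, …)` lies in `U`
has asymptotic density one. -/
def IsVaguePseudoOrbit (T : X → X) (x : ℕ → X) : Prop :=
  ∀ U : Set (ℕ → X), IsOpen U → orbitSpace T ⊆ U →
    HasAsymptoticDensity {n : ℕ | (fun i : ℕ => x (n + i)) ∈ U} 1

/-- The vague specification property. -/
def HasVagueSpecification (T : X → X) : Prop :=
  ∀ x : ℕ → X, IsVaguePseudoOrbit T x →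
    ∃ z : X, ∀ ε : ℝ, 0 < ε → HasAsymptoticDensity {n : ℕ | dist (T^[n] z) (x n) < ε} 1

end Vague

/-- The time intervals `[a i, b i]`, `i < m`, are consecutive and `M`-spaced:
`a 0 ≤ b 0 < a 1 ≤ b 1 < …`, and the gap before an interval is at least `M` evaluated at the
number of integers in that interval. -/
structure IsSpaced (M : ℕ → ℕ) (m : ℕ) (a b : ℕ → ℕ) : Prop where
  le : ∀ i, i < m → a i ≤ b i
  lt : ∀ i, i + 1 < m → b i < a (i + 1)
  gap : ∀ i, i + 1 < m → b i + M (b (i + 1) - a (i + 1) + 1) ≤ a (i + 1)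

section Specification

variable {X : Type*} [MetricSpace X]

/-- The weak specification property: for every `ε > 0` there is a nondecreasing sublinear gap
function `M` such that every finite `M`-spaced family of orbit segments
`(T^k (x i))`, `a i ≤ k ≤ b i`, is `ε`-traced by a single point `y`. -/
def HasWeakSpecification (T : X → X) : Prop :=
  ∀ ε : ℝ, 0 < ε → ∃ M : ℕ → ℕ, Monotone M ∧
    Tendsto (fun n : ℕ => (M n : ℝ) / (n : ℝ)) atTop (𝓝 0) ∧
    ∀ (m : ℕ) (a b : ℕ → ℕ) (x : ℕ → X), IsSpaced M m a b →
      ∃ y : X, ∀ i, i < m → ∀ k, a i ≤ k → k ≤ b i → dist (T^[k] y) (T^[k] (x i)) ≤ ε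

/-- A mistake function `g (n, ε)`: for each `ε > 0`, nondecreasing and sublinear in `n`. -/
def IsMistakeFunction (g : ℕ → ℝ → ℕ) : Prop :=
  ∀ ε : ℝ, 0 < ε → Monotone (fun n : ℕ => g n ε) ∧
    Tendsto (fun n : ℕ => (g n ε : ℝ) / (n : ℝ)) atTop (𝓝 0)

/-- The Bowen ball with mistakes `B_n(g; x, ε)`: the points whose first `n` iterates are
`ε`-close to those of `x`, with at most `g (n, ε)` exceptions. -/
def mistakeBowenBall (T : X → X) (g : ℕ → ℝ → ℕ) (n : ℕ) (x : X) (ε : ℝ) : Set X :=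
  {y | ∃ Λ : Finset ℕ, Λ ⊆ Finset.range n ∧ n ≤ Λ.card + g n ε ∧
    ∀ j ∈ Λ, dist (T^[j] x) (T^[j] y) < ε}

/-- The almost specification property: there are a mistake function `g` and a function `k` such
that, for all `ε_j > 0`, all points `x_j` and all lengths `n_j ≥ k (ε_j)` (`j < m`), there is a
point `y` with `T^{n_0 + ⋯ + n_{j-1}} y ∈ B_{n_j}(g; x_j, ε_j)` for every `j < m`. -/
def HasAlmostSpecification (T : X → X) : Prop :=
  ∃ (g : ℕ → ℝ → ℕ) (k : ℝ → ℕ), IsMistakeFunction g ∧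
    ∀ (m : ℕ) (ε : ℕ → ℝ) (x : ℕ → X) (n : ℕ → ℕ),
      (∀ j, j < m → 0 < ε j ∧ k (ε j) ≤ n j) →
      ∃ y : X, ∀ j, j < m →
        T^[∑ i ∈ Finset.range j, n i] y ∈ mistakeBowenBall T g (n j) (x j) (ε j)

end Specification

/-! Weak specification implies vague specification: cut time into periods of length `N` with `M N /
N` small. By compactness, most periods of a vague pseudo-orbit are close to genuine orbit segments,
and weak specification traces any finite run of them except for the first `M N` times of each. Doing
this with accuracy `2⁻ʲ` on successive windows `[t j, t (j + 1))`, each new point staying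
`2⁻ʲ`-close to the previous one before `t j`, gives a Cauchy sequence whose limit traces the
pseudo-orbit off a set of density zero (`HasAsymptoticDensity.of_diagonal`). For strictness, let
`1/(n+1) ↦ 1/n` and `1 ↦ 0 ↦ 0`. Every orbit is near `0` outside a time window of bounded length, so
the fixed point `0` traces everything up to negligible error; but no orbit visits `1` twice, which
defeats weak specification. -/

/-! ### Sets of density one -/

theorem ncard_Iio_nat (n : ℕ) : (Set.Iio n).ncard = n := by
  rw [← Finset.coe_Iio, Set.ncard_coe_finset, Nat.card_Iio]

theorem hasAsymptoticDensity_one_iff {A : Set ℕ} :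
    HasAsymptoticDensity A 1 ↔
      ∀ ε : ℝ, 0 < ε → ∀ᶠ n : ℕ in atTop, ((Aᶜ ∩ Set.Iio n).ncard : ℝ) ≤ ε * n := by
  have key : ∀ n : ℕ, ((A ∩ Set.Iio n).ncard : ℝ) = n - (Aᶜ ∩ Set.Iio n).ncard := by
    intro n
    have h := Set.ncard_inter_add_ncard_sdiff_eq_ncard (Set.Iio n) A (Set.finite_Iio n)
    rw [ncard_Iio_nat, Set.inter_comm, Set.sdiff_eq, Set.inter_comm (Set.Iio n) Aᶜ] at h
    have h' : ((A ∩ Set.Iio n).ncard : ℝ) + (Aᶜ ∩ Set.Iio n).ncard = n := by exact_mod_cast h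
    linarith
  have dist_eq : ∀ n : ℕ, 0 < n →
      dist (((A ∩ Set.Iio n).ncard : ℝ) / n) 1 = ((Aᶜ ∩ Set.Iio n).ncard : ℝ) / n := by
    intro n hn
    have hn' : (n : ℝ) ≠ 0 := by positivity
    rw [key n, sub_div, div_self hn', Real.dist_eq, sub_right_comm, sub_self, zero_sub, abs_neg,
      abs_of_nonneg (by positivity)]
  rw [HasAsymptoticDensity, Metric.tendsto_nhds]
  constructor
  · intro h ε hε
    filter_upwards [h ε hε, eventually_gt_atTop 0] with n hn hn0
    rw [dist_eq n hn0, div_lt_iff₀ (by exact_mod_cast hn0)] at hn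
    exact hn.le
  · intro h ε hε
    filter_upwards [h (ε / 2) (half_pos hε), eventually_gt_atTop 0] with n hn hn0
    have hn0' : (0 : ℝ) < n := by exact_mod_cast hn0
    rw [dist_eq n hn0, div_lt_iff₀ hn0']
    nlinarith

theorem HasAsymptoticDensity.mono_one {A B : Set ℕ} (hA : HasAsymptoticDensity A 1) (h : A ⊆ B) :
    HasAsymptoticDensity B 1 := by
  rw [hasAsymptoticDensity_one_iff] at hA ⊢
  intro ε hε
  filter_upwards [hA ε hε] with n hn
  refine le_trans (Nat.cast_le.mpr (Set.ncard_le_ncard ?_ ?_)) hn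
  · exact Set.inter_subset_inter_left _ (Set.compl_subset_compl.mpr h)
  · exact (Set.finite_Iio n).inter_of_right _

theorem HasAsymptoticDensity.of_shift {A : Set ℕ} (k : ℕ)
    (h : HasAsymptoticDensity {n | n + k ∈ A} 1) : HasAsymptoticDensity A 1 := by
  rw [hasAsymptoticDensity_one_iff] at h ⊢
  intro ε hε
  filter_upwards [h (ε / 2) (half_pos hε),
    tendsto_natCast_atTop_atTop.eventually_ge_atTop (k / (ε / 2) : ℝ)] with n hn hk
  rw [div_le_iff₀ (half_pos hε)] at hk
  have hsub : Aᶜ ∩ Set.Iio n ⊆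
      (fun i => i + k) '' ({m | m + k ∈ A}ᶜ ∩ Set.Iio n) ∪ Set.Iio k := by
    rintro i ⟨hi, hin⟩
    rcases lt_or_ge i k with hik | hik
    · exact Or.inr hik
    · refine Or.inl ⟨i - k, ⟨?_, ?_⟩, Nat.sub_add_cancel hik⟩
      · simpa [Nat.sub_add_cancel hik] using hi
      · exact lt_of_le_of_lt (Nat.sub_le i k) hin
  have hfin : ({m | m + k ∈ A}ᶜ ∩ Set.Iio n).Finite := (Set.finite_Iio n).inter_of_right _
  have h1 := Set.ncard_le_ncard hsub ((hfin.image _).union (Set.finite_Iio k))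
  have h2 := h1.trans (Set.ncard_union_le _ _)
  have h3 := h2.trans (Nat.add_le_add_right (Set.ncard_image_le hfin) _)
  rw [ncard_Iio_nat] at h3
  have h4 : ((Aᶜ ∩ Set.Iio n).ncard : ℝ) ≤ ({m | m + k ∈ A}ᶜ ∩ Set.Iio n).ncard + k := by
    exact_mod_cast h3
  linarith

/-- If `D` has at most `M` elements in each period `[N q, N q + N)` that starts in a set `G` of
density one, then the upper density of `D` is at most `M / N`. -/
theorem eventually_ncard_le_of_periods {G D : Set ℕ} {N M : ℕ} (hN : 0 < N)
    (hG : HasAsymptoticDensity G 1)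
    (hD : ∀ q, N * q ∈ G → (D ∩ Set.Ico (N * q) (N * q + N)).ncard ≤ M) {c : ℝ}
    (hc : (M : ℝ) / N < c) :
    ∀ᶠ n : ℕ in atTop, ((D ∩ Set.Iio n).ncard : ℝ) ≤ c * n := by
  classical
  have hN' : (0 : ℝ) < N := by exact_mod_cast hN
  obtain ⟨δ, hδ, hδc⟩ : ∃ δ : ℝ, 0 < δ ∧ (M : ℝ) / N + 3 * δ = c :=
    ⟨(c - M / N) / 3, by linarith, by ring⟩
  rw [hasAsymptoticDensity_one_iff] at hG
  filter_upwards [hG (δ / N) (by positivity),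
    tendsto_natCast_atTop_atTop.eventually_ge_atTop ((M + N : ℝ) / δ)] with n hn hnM
  rw [div_le_iff₀ hδ] at hnM
  set Q := n / N + 1
  have hsub : D ∩ Set.Iio n ⊆
      ⋃ q ∈ Finset.range Q, (D ∩ Set.Ico (N * q) (N * q + N)) := by
    rintro i ⟨hi, hin⟩
    have h1 := Nat.div_add_mod i N
    have h2 := Nat.mod_lt i hN
    have h3 : i / N ≤ n / N := Nat.div_le_div_right (le_of_lt hin)
    simp only [Set.mem_iUnion, Finset.mem_range]
    exact ⟨i / N, by omega, hi, by omega, by omega⟩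
  have hcard : (D ∩ Set.Iio n).ncard ≤
      ∑ q ∈ Finset.range Q, (M + if N * q ∈ G then 0 else N) := by
    refine (Set.ncard_le_ncard hsub ?_).trans ((Finset.set_ncard_biUnion_le _ _).trans ?_)
    · exact Set.Finite.biUnion (Finset.finite_toSet _)
        fun q _ => (Set.finite_Ico _ _).inter_of_right _
    · refine Finset.sum_le_sum fun q _ => ?_
      split_ifs with h
      · simpa using hD q h
      · refine (Set.ncard_le_ncard Set.inter_subset_right (Set.finite_Ico _ _)).trans ?_
        rw [← Finset.coe_Ico, Set.ncard_coe_finset, Nat.card_Ico]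
        omega
  -- Bad periods inject into `Gᶜ` by their starting times; the extra `1` allows for a last period
  -- starting exactly at `n`.
  have hbad : (∑ q ∈ Finset.range Q, if N * q ∈ G then 0 else N) ≤
      N * ((Gᶜ ∩ Set.Iio n).ncard + 1) := by
    rw [show (∑ q ∈ Finset.range Q, if N * q ∈ G then 0 else N) =
      N * {q ∈ Finset.range Q | N * q ∉ G}.card by simp [Finset.sum_ite, mul_comm]]
    refine Nat.mul_le_mul_left _ ?_
    rw [← Set.ncard_coe_finset,
      ← Set.ncard_image_of_injective _ (fun _ _ => Nat.eq_of_mul_eq_mul_left hN)]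
    refine (Set.ncard_le_ncard (t := insert n (Gᶜ ∩ Set.Iio n)) ?_
      (((Set.finite_Iio n).inter_of_right _).insert n)).trans (Set.ncard_insert_le _ _)
    rintro _ ⟨q, hq, rfl⟩
    simp only [Finset.coe_filter, Finset.mem_range, Set.mem_ofPred_eq] at hq
    have h1 : N * q ≤ n := (Nat.mul_le_mul_left N (Nat.lt_succ_iff.mp hq.1)).trans
      (Nat.mul_div_le n N)
    rcases h1.eq_or_lt with h | h
    · exact Or.inl h
    · exact Or.inr ⟨hq.2, h⟩
  rw [Finset.sum_add_distrib, Finset.sum_const, Finset.card_range, smul_eq_mul] at hcard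
  have h5 : ((D ∩ Set.Iio n).ncard : ℝ) ≤ Q * M + N * ((Gᶜ ∩ Set.Iio n).ncard + 1) := by
    exact_mod_cast hcard.trans (Nat.add_le_add_left hbad _)
  have h6 : (Q : ℝ) ≤ n / N + 1 := by
    have : ((n / N : ℕ) : ℝ) ≤ n / N := Nat.cast_div_le
    push_cast [Q]
    linarith
  have h7 : (N : ℝ) * (Gᶜ ∩ Set.Iio n).ncard ≤ δ * n := by
    calc (N : ℝ) * (Gᶜ ∩ Set.Iio n).ncard ≤ N * (δ / N * n) := by gcongr
      _ = δ * n := by field_simp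
  have h8 : (Q : ℝ) * M ≤ (n / N + 1) * M := by gcongr
  have h9 : (0 : ℝ) ≤ δ * n := by positivity
  calc ((D ∩ Set.Iio n).ncard : ℝ) ≤ (n / N + 1) * M + δ * n + N := by linarith
    _ = M / N * n + δ * n + (M + N) := by ring
    _ ≤ M / N * n + δ * n + n * δ := by linarith
    _ ≤ c * n := by rw [← hδc]; linarith

/-- Diagonal argument: a set that is covered on `[t i, t (i + 1))` by a set whose proportion in
`[0, n)` is at most `2⁻ⁱ` for all `n ≥ t i` has density zero. -/
theorem HasAsymptoticDensity.of_diagonal {A : Set ℕ} {D : ℕ → Set ℕ} {t : ℕ → ℕ}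
    (ht : StrictMono t) (hD : ∀ i n, t i ≤ n → ((D i ∩ Set.Iio n).ncard : ℝ) ≤ (1 / 2) ^ i * n)
    (i₀ : ℕ) (hA : ∀ i n, i₀ ≤ i → t i ≤ n → n < t (i + 1) → n ∉ D i → n ∈ A) :
    HasAsymptoticDensity A 1 := by
  rw [hasAsymptoticDensity_one_iff]
  intro ε hε
  obtain ⟨j, hj⟩ := exists_pow_lt_of_lt_one (show 0 < ε / 4 by positivity)
    (show (1 / 2 : ℝ) < 1 by norm_num)
  set l := max i₀ j
  have hl : ((1 : ℝ) / 2) ^ l ≤ ε / 4 :=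
    (pow_le_pow_of_le_one (by norm_num) (by norm_num) (le_max_right _ _)).trans hj.le
  -- The coefficient is the geometric sum of `2⁻ⁱ` over `l ≤ i < l + k`, one term per window.
  have key : ∀ k n : ℕ, n ≤ t (l + k) →
      ((Aᶜ ∩ Set.Iio n).ncard : ℝ) ≤ t l + 2 * ((1 / 2) ^ l - (1 / 2) ^ (l + k)) * n := by
    intro k
    induction k with
    | zero =>
      intro n hn
      have := Set.ncard_le_ncard (Set.inter_subset_right (s := Aᶜ) (t := Set.Iio n))
        (Set.finite_Iio n)
      rw [ncard_Iio_nat] at this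
      have h : ((Aᶜ ∩ Set.Iio n).ncard : ℝ) ≤ t l := by exact_mod_cast this.trans hn
      simpa using h
    | succ k ih =>
      intro n hn
      have hpow : ((1 : ℝ) / 2) ^ (l + (k + 1)) = (1 / 2) ^ (l + k) / 2 := by
        rw [← add_assoc, pow_succ]; ring
      have hpos : (0 : ℝ) ≤ (1 / 2) ^ (l + k) * n := by positivity
      rcases le_or_gt n (t (l + k)) with h | h
      · have := ih n h
        rw [hpow]
        linarith
      · have hsub : Aᶜ ∩ Set.Iio n ⊆ (Aᶜ ∩ Set.Iio (t (l + k))) ∪ (D (l + k) ∩ Set.Iio n) := by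
          rintro i ⟨hi, hin⟩
          rcases lt_or_ge i (t (l + k)) with h' | h'
          · exact Or.inl ⟨hi, h'⟩
          · refine Or.inr ⟨?_, hin⟩
            by_contra hd
            exact hi (hA (l + k) i ((le_max_left _ _).trans (Nat.le_add_right _ _)) h'
              (lt_of_lt_of_le hin hn) hd)
        have h1 := (Set.ncard_le_ncard hsub (((Set.finite_Iio _).inter_of_right _).union
          ((Set.finite_Iio _).inter_of_right _))).trans (Set.ncard_union_le _ _)
        have h2 : ((Aᶜ ∩ Set.Iio n).ncard : ℝ) ≤
            (Aᶜ ∩ Set.Iio (t (l + k))).ncard + (D (l + k) ∩ Set.Iio n).ncard := by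
          exact_mod_cast h1
        have h3 := ih _ le_rfl
        have h4 := hD (l + k) n h.le
        have h5 : 2 * (((1 : ℝ) / 2) ^ l - (1 / 2) ^ (l + k)) * t (l + k) ≤
            2 * ((1 / 2) ^ l - (1 / 2) ^ (l + k)) * n := by
          have h6 : ((1 : ℝ) / 2) ^ (l + k) ≤ (1 / 2) ^ l :=
            pow_le_pow_of_le_one (by norm_num) (by norm_num) (Nat.le_add_right _ _)
          have h7 : (t (l + k) : ℝ) ≤ n := by exact_mod_cast h.le
          exact mul_le_mul_of_nonneg_left h7 (by linarith)
        rw [hpow]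
        linarith
  filter_upwards [tendsto_natCast_atTop_atTop.eventually_ge_atTop (t l / (ε / 2) : ℝ)] with n hn
  rw [div_le_iff₀ (half_pos hε)] at hn
  have h1 := key n n ((ht.id_le n).trans (ht.monotone (Nat.le_add_left _ _)))
  have h2 : (0 : ℝ) ≤ (1 / 2) ^ (l + n) * n := by positivity
  have h3 : ((1 : ℝ) / 2) ^ l * n ≤ ε / 4 * n := by gcongr
  linarith

/-! ### Weak specification implies vague specification -/

section VagueOfWeak

variable {X : Type*} [MetricSpace X] {T : X → X}

theorem isOpen_exists_forall_dist_lt (S : Set X) (N : ℕ) (ε : ℝ) :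
    IsOpen {ξ : ℕ → X | ∃ v ∈ S, ∀ i < N, dist (T^[i] v) (ξ i) < ε} := by
  have : {ξ : ℕ → X | ∃ v ∈ S, ∀ i < N, dist (T^[i] v) (ξ i) < ε} =
      ⋃ v ∈ S, ⋂ i ∈ Set.Iio N, {ξ : ℕ → X | dist (T^[i] v) (ξ i) < ε} := by
    ext ξ; simp
  rw [this]
  refine isOpen_biUnion fun v _ => (Set.finite_Iio N).isOpen_biInter fun i _ => ?_
  exact isOpen_lt (by fun_prop) continuous_const

/-- Most segments of length `N` of a vague pseudo-orbit are `ε`-close to the orbit segment of some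
point at the same times. -/
theorem IsVaguePseudoOrbit.hasAsymptoticDensity_traced [CompactSpace X] (hT : Continuous T)
    {x : ℕ → X} (hx : IsVaguePseudoOrbit T x) (N : ℕ) {ε : ℝ} (hε : 0 < ε) :
    HasAsymptoticDensity {s | ∃ w, ∀ i < N, dist (T^[s + i] w) (x (s + i)) < ε} 1 := by
  -- Tracing is at absolute times, so the segment starting at time `s` must begin at some `T^[s] w`;
  -- points of `S` have preimages of every order.
  set S : Set X := ⋂ k, Set.range T^[k]
  set U : Set (ℕ → X) := {ξ | ∃ v ∈ S, ∀ i < N, dist (T^[i] v) (ξ i) < ε}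
  have hU : IsOpen U := isOpen_exists_forall_dist_lt S N ε
  have hS : ∀ v ∈ S, ∀ᶠ u in 𝓝 v, (fun i => T^[i] u) ∈ U := by
    intro v hv
    have hc : Continuous fun u : X => fun i : ℕ => T^[i] u :=
      continuous_pi fun i => hT.iterate i
    exact hc.continuousAt.eventually_mem (hU.mem_nhds ⟨v, hv, fun i _ => by simpa using hε⟩)
  -- The compact images decrease to `S`, so one of them lies in this neighbourhood of `S`. Hence
  -- every orbit enters `U` after being shifted by `k`.
  obtain ⟨k, hk⟩ : ∃ k, Set.range T^[k] ⊆ {u | (fun i => T^[i] u) ∈ U} := by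
    refine exists_subset_nhds_of_isCompact (V := fun k => Set.range T^[k]) ?_ ?_ hS
    · refine (antitone_nat_of_succ_le fun k => ?_).directed_ge
      rintro _ ⟨u, rfl⟩
      exact ⟨T u, (Function.iterate_succ_apply T k u).symm⟩
    · exact fun k => isCompact_range (hT.iterate k)
  have hV : IsOpen ((fun (ξ : ℕ → X) (i : ℕ) => ξ (k + i)) ⁻¹' U) :=
    hU.preimage (by fun_prop)
  refine HasAsymptoticDensity.of_shift k ?_
  have hd := hx _ hV ?_
  · refine hd.mono_one ?_
    rintro m ⟨v, hv, h⟩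
    obtain ⟨w, rfl⟩ := Set.mem_iInter.mp hv (m + k)
    refine ⟨w, fun i hi => ?_⟩
    have := h i hi
    rw [← Function.iterate_add_apply, add_comm i] at this
    simpa only [add_assoc] using this
  · rintro _ ⟨u, rfl⟩
    have := hk ⟨u, rfl⟩
    simpa only [Set.mem_ofPred_eq, Set.mem_preimage, ← Function.iterate_add_apply,
      add_comm k] using this

/-- Weak specification, in the form: a point can be replaced by one that follows it up to time
`N u` and then follows prescribed orbits on all later periods of length `N`, after a waiting time
of `M`. -/
theorem exists_tracing_periods {ε : ℝ} {M : ℕ → ℕ} (hM : Monotone M)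
    (h : ∀ (m : ℕ) (a b : ℕ → ℕ) (x : ℕ → X), IsSpaced M m a b →
      ∃ y : X, ∀ i, i < m → ∀ k, a i ≤ k → k ≤ b i → dist (T^[k] y) (T^[k] (x i)) ≤ ε)
    {N : ℕ} (hN : M N < N) {u : ℕ} (hu : 0 < u) (m : ℕ) (w : ℕ → X) (y : X) :
    ∃ y' : X, (∀ k < N * u, dist (T^[k] y') (T^[k] y) ≤ ε) ∧
      ∀ q, u ≤ q → q < u + m → ∀ i < N, M N ≤ i →
        dist (T^[N * q + i] y') (T^[N * q + i] (w q)) ≤ ε := by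
  -- Interval `0` is `[0, N * u)`, following `y`; interval `i + 1` is period `u + i` without its
  -- first `M N` times. Its length is at most `N`, so monotonicity of `M` bounds the required gap by
  -- `M N`.
  let a : ℕ → ℕ := fun i => if i = 0 then 0 else N * (u + i - 1) + M N
  let b : ℕ → ℕ := fun i => N * (u + i) - 1
  let p : ℕ → X := fun i => if i = 0 then y else w (u + i - 1)
  have hb : ∀ i, b i + 1 = N * (u + i) := fun i =>
    Nat.sub_add_cancel (Nat.mul_pos (by omega) (by omega))
  have ha : ∀ i, a (i + 1) = N * (u + i) + M N := fun i => by simp [a, ← add_assoc]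
  have hab : ∀ i, b (i + 1) + M N + 1 = a (i + 1) + N := fun i => by
    have := hb (i + 1)
    have e : N * (u + (i + 1)) = N * (u + i) + N := by ring
    rw [ha i]; omega
  obtain ⟨y', hy'⟩ := h (m + 1) a b p
    { le := by
        rintro (_ | i) -
        · exact Nat.zero_le _
        · have := hab i; omega
      lt := fun i _ => by have := hb i; have := ha i; omega
      gap := fun i _ => by
        have h1 := hab i
        have h2 : M (b (i + 1) - a (i + 1) + 1) ≤ M N := hM (by omega)
        have := hb i
        have := ha i
        omega }
  refine ⟨y', fun k hk => ?_, fun q hq hqm i hi hMi => ?_⟩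
  · have := hy' 0 (by omega) k (Nat.zero_le _) (by have := hb 0; simp at this; omega)
    simpa [p] using this
  · obtain ⟨r, rfl⟩ := Nat.exists_eq_add_of_le hq
    have := hy' (r + 1) (by omega) (N * (u + r) + i) (by rw [ha]; omega)
      (by have := hab r; have := ha r; omega)
    simpa [p, ← add_assoc] using this

theorem HasWeakSpecification.hasVagueSpecification [CompactSpace X] (hT : Continuous T)
    (h : HasWeakSpecification T) : HasVagueSpecification T := by
  intro x hx
  have hε : ∀ j : ℕ, (0 : ℝ) < (1 / 2) ^ j := fun j => by positivity
  choose M hM hMlim htrace using fun j => h _ (hε j)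
  have hNex : ∀ j, ∃ N, (M j N : ℝ) / N < (1 / 2) ^ j ∧ 0 < N := fun j =>
    (((hMlim j).eventually_lt_const (hε j)).and (eventually_gt_atTop 0)).exists
  choose N hN hN0 using hNex
  have hMN : ∀ j, M j (N j) < N j := by
    intro j
    have h1 := (hN j).trans_le (pow_le_one₀ (by norm_num) (by norm_num))
    rw [div_lt_one (by exact_mod_cast hN0 j)] at h1
    exact_mod_cast h1
  let G : ℕ → Set ℕ := fun j =>
    {s | ∃ w, ∀ i < N j, dist (T^[s + i] w) (x (s + i)) < (1 / 2) ^ j}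
  have hG : ∀ j, HasAsymptoticDensity (G j) 1 := fun j =>
    hx.hasAsymptoticDensity_traced hT (N j) (hε j)
  have hwex : ∀ j s, ∃ w, s ∈ G j → ∀ i < N j, dist (T^[s + i] w) (x (s + i)) < (1 / 2) ^ j := by
    intro j s
    by_cases hs : s ∈ G j
    · obtain ⟨w, hw⟩ := hs
      exact ⟨w, fun _ => hw⟩
    · exact ⟨x 0, fun hs' => absurd hs' hs⟩
  choose w hw using hwex
  let D : ℕ → Set ℕ := fun j => {n | n % N j < M j (N j) ∨ N j * (n / N j) ∉ G j}
  have hDev : ∀ j, ∃ K, ∀ n ≥ K, ((D j ∩ Set.Iio n).ncard : ℝ) ≤ (1 / 2) ^ j * n := by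
    intro j
    refine eventually_atTop.mp
      (eventually_ncard_le_of_periods (hN0 j) (hG j) (M := M j (N j)) ?_ (hN j))
    intro q hq
    have hsub : D j ∩ Set.Ico (N j * q) (N j * q + N j) ⊆
        Set.Ico (N j * q) (N j * q + M j (N j)) := by
      rintro n ⟨hn, h1, h2⟩
      have hdiv : n / N j = q := Nat.div_eq_of_lt_le (by rw [mul_comm]; exact h1)
        (by rw [add_mul, mul_comm q]; omega)
      have h3 := Nat.div_add_mod n (N j)
      rw [hdiv] at h3
      rcases hn with hn | hn
      · exact ⟨h1, by omega⟩
      · exact absurd (hdiv ▸ hq) hn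
    refine (Set.ncard_le_ncard hsub (Set.finite_Ico _ _)).trans ?_
    rw [← Finset.coe_Ico, Set.ncard_coe_finset, Nat.card_Ico, Nat.add_sub_cancel_left]
  choose K hK using hDev
  -- Chosen so that `t j = N j * u j` is a multiple of `N j`, is at least `K j`, and increases
  -- strictly.
  let u : ℕ → ℕ := fun j => Nat.rec (K 0 + 1) (fun j r => K (j + 1) + N j * r + 1) j
  have hu0 : ∀ j, 0 < u j := by rintro (_ | j) <;> exact Nat.succ_pos _
  let t : ℕ → ℕ := fun j => N j * u j
  have hut : ∀ j, u j ≤ t j := fun j => Nat.le_mul_of_pos_left _ (hN0 j)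
  have hKt : ∀ j, K j ≤ t j := by
    intro j
    refine le_trans ?_ (hut j)
    rcases j with _ | j
    · exact Nat.le_succ _
    · show K (j + 1) ≤ K (j + 1) + N j * u j + 1
      omega
  have ht : StrictMono t := by
    refine strictMono_nat_of_lt_succ fun j => lt_of_lt_of_le ?_ (hut (j + 1))
    show N j * u j < K (j + 1) + N j * u j + 1
    omega
  have hstep : ∀ j (y : X), ∃ y', (∀ n < t j, dist (T^[n] y) (T^[n] y') ≤ (1 / 2) ^ j) ∧
      ∀ n, t j ≤ n → n < t (j + 1) → n ∉ D j → dist (T^[n] y') (x n) ≤ 2 * (1 / 2) ^ j := by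
    intro j y
    -- `t (j + 1)` periods are more than enough, since `n / N j ≤ n < t (j + 1)`.
    obtain ⟨y', h1, h2⟩ := exists_tracing_periods (hM j) (htrace j) (hMN j) (hu0 j) (t (j + 1))
      (fun q => w j (N j * q)) y
    refine ⟨y', fun n hn => by rw [dist_comm]; exact h1 n hn, fun n hn hn' hnD => ?_⟩
    obtain ⟨hmod, hgood⟩ : M j (N j) ≤ n % N j ∧ N j * (n / N j) ∈ G j := by
      simpa [D, not_or] using hnD
    have h3 := h2 (n / N j) ((Nat.le_div_iff_mul_le (hN0 j)).mpr (by rw [mul_comm]; exact hn))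
      (((Nat.div_le_self _ _).trans_lt hn').trans_le (Nat.le_add_left _ _))
      (n % N j) (Nat.mod_lt _ (hN0 j)) hmod
    have h4 := hw j (N j * (n / N j)) hgood (n % N j) (Nat.mod_lt _ (hN0 j))
    rw [Nat.div_add_mod] at h3 h4
    linarith [dist_triangle (T^[n] y') (T^[n] (w j (N j * (n / N j)))) (x n)]
  choose f hf hfx using hstep
  let y : ℕ → X := fun j => Nat.rec (x 0) f j
  have hclose : ∀ j n, n < t j → dist (T^[n] (y j)) (T^[n] (y (j + 1))) ≤ (1 / 2) ^ j :=
    fun j n hn => hf j (y j) n hn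
  have hcauchy : CauchySeq y := cauchySeq_of_le_geometric (1 / 2) 1 (by norm_num) fun j => by
    simpa using hclose j 0 (Nat.mul_pos (hN0 j) (hu0 j))
  obtain ⟨z, hz⟩ := cauchySeq_tendsto_of_complete hcauchy
  have hzy : ∀ j n, n < t j → dist (T^[n] (y j)) (T^[n] z) ≤ 2 * (1 / 2) ^ j := by
    intro j n hn
    have hlim : Tendsto (fun k => T^[n] (y (k + j))) atTop (𝓝 (T^[n] z)) :=
      ((hT.iterate n).tendsto z).comp ((tendsto_add_atTop_iff_nat j).mpr hz)
    have := dist_le_of_le_geometric_of_tendsto₀ (1 / 2) ((1 / 2) ^ j) (by norm_num)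
      (fun k => ?_) hlim
    · rw [zero_add] at this
      exact this.trans_eq (by ring)
    · have h1 := hclose (k + j) n (hn.trans_le (ht.monotone (Nat.le_add_left _ _)))
      rw [pow_add, mul_comm, add_right_comm] at h1
      exact h1
  refine ⟨z, fun ε hε' => ?_⟩
  -- The final error is `2 * 2⁻⁽ʲ⁺¹⁾ + 2 * 2⁻ʲ = 3 * 2⁻ʲ`.
  obtain ⟨i₀, hi₀⟩ := exists_pow_lt_of_lt_one (show 0 < ε / 3 by positivity)
    (show (1 / 2 : ℝ) < 1 by norm_num)
  refine HasAsymptoticDensity.of_diagonal ht (fun j n hn => hK j n ((hKt j).trans hn)) i₀ ?_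
  intro j n hj h1 h2 hnD
  have h3 := hzy (j + 1) n h2
  have h4 : dist (T^[n] (y (j + 1))) (x n) ≤ 2 * (1 / 2) ^ j := hfx j (y j) n h1 h2 hnD
  have h5 : ((1 : ℝ) / 2) ^ j ≤ (1 / 2) ^ i₀ :=
    pow_le_pow_of_le_one (by norm_num) (by norm_num) hj
  rw [pow_succ] at h3
  show dist (T^[n] z) (x n) < ε
  linarith [dist_triangle_left (T^[n] z) (x n) (T^[n] (y (j + 1)))]

end VagueOfWeak

/-! ### Systems absorbed by a fixed point -/

section Absorbing

variable {X : Type*} [MetricSpace X] {T : X → X}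

/-- Every orbit is close to `p` outside a time window whose length does not depend on the orbit. -/
def IsUniformlyAbsorbing (T : X → X) (p : X) : Prop :=
  ∀ ε : ℝ, 0 < ε → ∃ K : ℕ, ∀ x : X, ∃ s : ℕ, ∀ i ∉ Finset.Ico s (s + K), dist (T^[i] x) p < ε

/-- The point `p` itself always works: its mistakes lie in one window of length `K ε`, so a mistake
function constant in `n` suffices. -/
theorem IsUniformlyAbsorbing.hasAlmostSpecification {p : X} (h : IsUniformlyAbsorbing T p)
    (hp : T p = p) : HasAlmostSpecification T := by
  have hex : ∀ ε : ℝ, ∃ K : ℕ, 0 < ε → ∀ x : X, ∃ s : ℕ,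
      ∀ i ∉ Finset.Ico s (s + K), dist (T^[i] x) p < ε := by
    intro ε
    by_cases hε : 0 < ε
    · obtain ⟨K, hK⟩ := h ε hε
      exact ⟨K, fun _ => hK⟩
    · exact ⟨0, fun hε' => absurd hε' hε⟩
  choose K hK using hex
  refine ⟨fun _ ε => K ε, fun _ => 0, fun ε _ => ⟨monotone_const, ?_⟩, fun m ε x n hε => ?_⟩
  · exact tendsto_const_nhds.div_atTop tendsto_natCast_atTop_atTop
  · refine ⟨p, fun j hj => ?_⟩
    obtain ⟨s, hs⟩ := hK (ε j) (hε j hj).1 (x j)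
    refine ⟨Finset.range (n j) \ Finset.Ico s (s + K (ε j)), Finset.sdiff_subset, ?_, ?_⟩
    · have := Finset.le_card_sdiff (Finset.Ico s (s + K (ε j))) (Finset.range (n j))
      rw [Nat.card_Ico, Finset.card_range] at this
      show n j ≤ _ + K (ε j)
      omega
    · intro i hi
      rw [Function.iterate_fixed hp, Function.iterate_fixed hp]
      exact hs i (Finset.mem_sdiff.mp hi).2

/-- Being close to `p` for `N` steps outside a window of length `K` is an open condition met by
every orbit. A vague pseudo-orbit therefore strays from `p` with upper density at most `K / N`, and
`N` is arbitrary. -/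
theorem IsUniformlyAbsorbing.hasVagueSpecification {p : X} (h : IsUniformlyAbsorbing T p)
    (hp : T p = p) : HasVagueSpecification T := by
  intro x hx
  refine ⟨p, fun ε hε => ?_⟩
  simp only [Function.iterate_fixed hp]
  obtain ⟨K, hK⟩ := h ε hε
  rw [hasAsymptoticDensity_one_iff]
  intro c hc
  obtain ⟨N, hN, hN0⟩ : ∃ N : ℕ, (K : ℝ) / N < c ∧ 0 < N :=
    (((tendsto_const_nhds.div_atTop tendsto_natCast_atTop_atTop).eventually_lt_const hc).and
      (eventually_gt_atTop 0)).exists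
  let U : Set (ℕ → X) :=
    ⋃ s : ℕ, ⋂ i ∈ Finset.range N \ Finset.Ico s (s + K), {ξ : ℕ → X | dist p (ξ i) < ε}
  have hU : IsOpen U := isOpen_iUnion fun s => isOpen_biInter_finset fun i _ =>
    isOpen_lt (by fun_prop) continuous_const
  refine eventually_ncard_le_of_periods (M := K) hN0 (hx U hU ?_) ?_ hN
  · rintro _ ⟨v, rfl⟩
    obtain ⟨s, hs⟩ := hK v
    refine Set.mem_iUnion.mpr ⟨s, Set.mem_iInter₂.mpr fun i hi => ?_⟩
    show dist p (T^[i] v) < ε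
    rw [dist_comm]
    exact hs i (Finset.mem_sdiff.mp hi).2
  · intro q hq
    obtain ⟨s, hs⟩ := Set.mem_iUnion.mp hq
    have hsub : {n | dist p (x n) < ε}ᶜ ∩ Set.Ico (N * q) (N * q + N) ⊆
        (Finset.Ico (N * q + s) (N * q + s + K) : Finset ℕ) := by
      rintro n ⟨hn, h1, h2⟩
      obtain ⟨i, rfl⟩ := Nat.exists_eq_add_of_le h1
      by_contra hi
      refine hn (Set.mem_iInter₂.mp hs i (Finset.mem_sdiff.mpr ⟨?_, fun hi' => hi ?_⟩))
      · exact Finset.mem_range.mpr (by omega)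
      · rw [Finset.mem_Ico] at hi'
        exact Finset.mem_coe.mpr (Finset.mem_Ico.mpr (by omega))
    have := Set.ncard_le_ncard hsub (Finset.finite_toSet _)
    rwa [Set.ncard_coe_finset, Nat.card_Ico, Nat.add_sub_cancel_left] at this

end Absorbing

/-! ### The counterexample -/

/-- The points `1, 1/2, 1/3, …` together with their limit `0`. -/
def reciprocals : Set ℝ := insert 0 (Set.range fun n : ℕ => 1 / ((n : ℝ) + 1))

/-- A continuous map of the line with `0 ↦ 0`, `1 ↦ 0` and `1 / (n + 1) ↦ 1 / n` for `n ≥ 1`. -/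
noncomputable def reciprocalMap (x : ℝ) : ℝ := min (x / max (1 - x) (1 / 2)) (2 - 2 * x)

theorem continuous_reciprocalMap : Continuous reciprocalMap := by
  refine Continuous.min (Continuous.div₀ continuous_id (by fun_prop) fun x => ?_) (by fun_prop)
  exact (lt_of_lt_of_le (by norm_num) (le_max_right _ _)).ne'

theorem reciprocalMap_zero : reciprocalMap 0 = 0 := by norm_num [reciprocalMap]

theorem reciprocalMap_one : reciprocalMap 1 = 0 := by norm_num [reciprocalMap]

theorem reciprocalMap_succ (n : ℕ) :
    reciprocalMap (1 / (((n + 1 : ℕ) : ℝ) + 1)) = 1 / ((n : ℝ) + 1) := by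
  have h0 : (0 : ℝ) ≤ n := n.cast_nonneg
  have h1 : 1 - 1 / ((n : ℝ) + 1 + 1) = (n + 1) / (n + 1 + 1) := by field_simp; ring
  have h2 : (1 : ℝ) / 2 ≤ (n + 1) / (n + 1 + 1) := by
    rw [div_le_div_iff₀ (by norm_num) (by positivity)]; linarith
  rw [reciprocalMap]
  push_cast
  -- For `x = 1 / (n + 2) ≤ 1 / 2` neither cut-off is active: the value is `x / (1 - x) ≤ 2 - 2 *
  -- x`.
  rw [h1, max_eq_left h2, min_eq_left]
  · field_simp
  · have h3 : 2 - 2 * (1 / ((n : ℝ) + 1 + 1)) = 2 * ((n + 1) / (n + 1 + 1)) := by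
      rw [← h1]; ring
    have h4 : 1 / ((n : ℝ) + 1 + 1) / ((n + 1) / (n + 1 + 1)) = 1 / (n + 1) := by field_simp
    rw [h3, h4, ← mul_div_assoc, div_le_div_iff₀ (by positivity) (by positivity)]
    nlinarith

theorem isCompact_reciprocals : IsCompact reciprocals :=
  tendsto_one_div_add_atTop_nhds_zero_nat.isCompact_insert_range

theorem mapsTo_reciprocalMap : Set.MapsTo reciprocalMap reciprocals reciprocals := by
  rintro _ (rfl | ⟨_ | n, rfl⟩)
  · rw [reciprocalMap_zero]; exact Set.mem_insert _ _
  · simp only [Nat.cast_zero, zero_add, div_one, reciprocalMap_one]; exact Set.mem_insert _ _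
  · exact Or.inr ⟨n, (reciprocalMap_succ n).symm⟩

theorem iterate_reciprocalMap_zero (i : ℕ) : reciprocalMap^[i] 0 = 0 :=
  Function.iterate_fixed reciprocalMap_zero i

theorem iterate_reciprocalMap_of_le {i n : ℕ} (h : i ≤ n) :
    reciprocalMap^[i] (1 / ((n : ℝ) + 1)) = 1 / (((n - i : ℕ) : ℝ) + 1) := by
  induction i generalizing n with
  | zero => simp
  | succ i ih =>
    obtain ⟨m, rfl⟩ := Nat.exists_eq_add_of_le' (Nat.one_le_of_lt h)
    rw [Function.iterate_succ_apply, reciprocalMap_succ, ih (by omega), Nat.add_sub_add_right]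

theorem iterate_reciprocalMap_of_lt {i n : ℕ} (h : n < i) :
    reciprocalMap^[i] (1 / ((n : ℝ) + 1)) = 0 := by
  obtain ⟨k, rfl⟩ := Nat.exists_eq_add_of_lt h
  rw [show n + k + 1 = k + 1 + n by ring, Function.iterate_add_apply,
    iterate_reciprocalMap_of_le le_rfl, Function.iterate_succ_apply]
  simp [reciprocalMap_one, iterate_reciprocalMap_zero]

/-- The dynamics of `reciprocalMap` on the compact set `{0} ∪ {1, 1/2, 1/3, …}`. -/
noncomputable def reciprocalSystem : reciprocals → reciprocals :=
  mapsTo_reciprocalMap.restrict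

theorem coe_iterate_reciprocalSystem (i : ℕ) (x : reciprocals) :
    (reciprocalSystem^[i] x : ℝ) = reciprocalMap^[i] x :=
  mapsTo_reciprocalMap.coe_iterate_restrict x i

theorem isUniformlyAbsorbing_reciprocalSystem :
    IsUniformlyAbsorbing reciprocalSystem ⟨0, Set.mem_insert _ _⟩ := by
  intro ε hε
  obtain ⟨K, hK⟩ := exists_nat_one_div_lt hε
  refine ⟨K + 1, ?_⟩
  rintro ⟨_, rfl | ⟨n, rfl⟩⟩
  · refine ⟨0, fun i _ => ?_⟩
    rw [Subtype.dist_eq, coe_iterate_reciprocalSystem, iterate_reciprocalMap_zero, dist_self]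
    exact hε
  -- The `i`-th iterate is `1 / (n - i + 1)` up to time `n`, then `0`; it can be `ε` or more only
  -- when `n - K < i ≤ n`.
  · refine ⟨n - K, fun i hi => ?_⟩
    rw [Subtype.dist_eq, coe_iterate_reciprocalSystem, Real.dist_0_eq_abs]
    rcases lt_or_ge n i with h | h
    · rw [iterate_reciprocalMap_of_lt h, abs_zero]
      exact hε
    · rw [iterate_reciprocalMap_of_le h, abs_of_nonneg (by positivity)]
      refine lt_of_le_of_lt (one_div_le_one_div_of_le (by positivity) ?_) hK
      rw [Finset.mem_Ico] at hi
      have : K ≤ n - i := by omega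
      gcongr

theorem not_hasWeakSpecification_reciprocalSystem : ¬ HasWeakSpecification reciprocalSystem := by
  intro h
  obtain ⟨M, -, -, hM⟩ := h (1 / 4) (by norm_num)
  let e : ℕ → reciprocals := fun n => ⟨1 / ((n : ℝ) + 1), Or.inr ⟨n, rfl⟩⟩
  let c := M 1 + 1
  -- The point `e (i * c)` is at `1` at time `i * c`, so `y` would have to be within `1 / 4` of `1`
  -- at times `0` and `c`. The first forces `y = 1`, which is at `0` by time `c`.
  obtain ⟨y, hy⟩ := hM 2 (fun i => i * c) (fun i => i * c) (fun i => e (i * c))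
    { le := fun _ _ => le_rfl
      lt := fun i _ => by rw [add_mul]; simp [c]
      gap := fun i _ => by rw [Nat.sub_self, add_mul]; simp [c] }
  have h0 := hy 0 (by norm_num) (0 * c) le_rfl le_rfl
  have h1 := hy 1 (by norm_num) (1 * c) le_rfl le_rfl
  rw [Subtype.dist_eq, coe_iterate_reciprocalSystem, coe_iterate_reciprocalSystem,
    iterate_reciprocalMap_of_le le_rfl, Real.dist_eq, abs_le] at h0 h1
  rw [Nat.zero_mul, Function.iterate_zero_apply] at h0
  rw [Nat.one_mul] at h1
  obtain ⟨_, rfl | ⟨n, rfl⟩⟩ := y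
  · norm_num at h0
  · rcases n with _ | n
    · rw [iterate_reciprocalMap_of_lt (by simp [c])] at h1
      norm_num at h1
    · have : 1 / (((n + 1 : ℕ) : ℝ) + 1) ≤ 1 / 2 :=
        one_div_le_one_div_of_le (by norm_num) (by push_cast; linarith [n.cast_nonneg (α := ℝ)])
      have h2 := h0.1
      simp only [Nat.sub_self, Nat.cast_zero, zero_add, div_one] at h2
      linarith

theorem mainTheorem6 :
    (∀ (X : Type*) [MetricSpace X] [CompactSpace X] (T : X → X), Continuous T →
      HasWeakSpecification T → HasVagueSpecification T) ∧
    (∃ (X : Type) (_ : MetricSpace X) (_ : CompactSpace X) (_ : Nonempty X) (T : X → X),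
      Continuous T ∧ HasAlmostSpecification T ∧ HasVagueSpecification T ∧
        ¬ HasWeakSpecification T) := by
  have hfix : reciprocalSystem ⟨0, Set.mem_insert _ _⟩ = ⟨0, Set.mem_insert _ _⟩ :=
    Subtype.ext reciprocalMap_zero
  exact ⟨fun X _ _ T hT h => h.hasVagueSpecification hT,
    reciprocals, inferInstance, isCompact_iff_compactSpace.mp isCompact_reciprocals,
    ⟨⟨0, Set.mem_insert _ _⟩⟩, reciprocalSystem,
    continuous_reciprocalMap.restrict mapsTo_reciprocalMap,
    isUniformlyAbsorbing_reciprocalSystem.hasAlmostSpecification hfix,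
    isUniformlyAbsorbing_reciprocalSystem.hasVagueSpecification hfix,
    not_hasWeakSpecification_reciprocalSystem⟩
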